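/- Let $\mathcal H$ be a complex Hilbert space, let $B$ be a bounded selfadjoint operator on $\mathcal H$, and let $\mathcal S$ be a closed subspace of $\mathcal H$ with orthogonal projection $P_{\mathcal S}$. Write $$B=\begin{bmatrix} a & b\\ b^* & c\end{bmatrix}$$ with respect to $\mathcal H=\mathcal S\oplus\mathcal S^\perp$, and $|T|=(T^*T)^{1/2}$. The operator $B$ is called $\mathcal S$-weakly complementable if $R(b)\subseteq R(|a|^{1/2})$. In that case let $f$ be the reduced solution of $b=|a|^{1/2}x$, that is, the unique bounded $f:\mathcal S^\perp\to\mathcal S$ with $b=|a|^{1/2}f$, $N(f)=N(b)$ and $R(f)\subseteq\overline{R(|a|^{1/2})}$, let $a=u|a|$ be the polar decomposition of $a$ ($u$ a partial isometry with $N(u)=N(a)$), and define the Schur complement of $B$ to $\mathcal S$ by $$B_{/\mathcal S}=\begin{bmatrix} 0&0\\ 0& c-f^*uf\end{bmatrix}.$$ A densely defined projection is a (not necessarily bounded or closed) linear operator $E$ on a dense subspace $\mathrm{Dom}(E)$ of $\mathcal H$ with $E(\mathrm{Dom}(E))\subseteq \mathrm{Dom}(E)$ and $E^2=E$; for a bounded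 operator $T$ on $\mathcal H$, the product $ET$ has domain $\{x\in\mathcal H: Tx\in \mathrm{Dom}(E)\}$. Then $B$ is $\mathcal S$-weakly complementable if and only if there exists a densely defined projection $E$ with nullspace $N(E)=\mathcal S^\perp$ such that $E\,|P_{\mathcal S}BP_{\mathcal S}|^{1/2}$ is an everywhere defined bounded operator on $\mathcal H$ and $EB$ is an everywhere defined bounded selfadjoint operator on $\mathcal H$. In this case, for every such $E$, the operator $(I-E)B$ is everywhere defined and $$B_{/\mathcal S}=(I-E)B.$$ -/

import Mathlib

noncomputable section

namespace WeakSchur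

section Factorization

variable {H K L : Type*}
  [NormedAddCommGroup H] [InnerProductSpace ℂ H] [CompleteSpace H]
  [NormedAddCommGroup K] [InnerProductSpace ℂ K] [CompleteSpace K]
  [NormedAddCommGroup L] [InnerProductSpace ℂ L] [CompleteSpace L]

/-- `D` is the reduced solution of `Z = Y X`: a solution with `N(D) = N(Z)` whose range lies in
the closure of `R(Y*)`. -/
structure IsReducedSolution (Z : K →L[ℂ] H) (Y : L →L[ℂ] H) (D : K →L[ℂ] L) : Prop where
  eq : Z = Y ∘L D
  ker_eq : D.ker = Z.ker
  range_le : D.range ≤ (ContinuousLinearMap.adjoint Y).range.topologicalClosure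

/-- Douglas' lemma: if `R(Z) ⊆ R(Y)`, the reduced solution of `Z = Y X` exists and is unique. -/
theorem existsUnique_reducedSolution (Z : K →L[ℂ] H) (Y : L →L[ℂ] H) (h : Z.range ≤ Y.range) :
    ∃! D : K →L[ℂ] L, IsReducedSolution Z Y D := by
  have hker : Y.kerᗮ = (ContinuousLinearMap.adjoint Y).range.topologicalClosure := by
    simpa using Y.orthogonal_ker
  have hinj : ∀ w ∈ Y.kerᗮ, Y w = 0 → w = 0 := by
    intro w hw h0
    have h1 : w ∈ Y.ker := by simpa using h0
    exact inner_self_eq_zero.mp ((Submodule.mem_orthogonal _ _).mp hw w h1)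
  have hex : ∀ x, ∃ w ∈ Y.kerᗮ, Y w = Z x := by
    intro x
    obtain ⟨v, hv⟩ := h ⟨x, rfl⟩
    have hcl : IsClosed (Y.ker : Set L) := Y.isClosed_ker
    have : CompleteSpace Y.ker := hcl.completeSpace_coe
    obtain ⟨p, hp, q, hq, hpq⟩ := Y.ker.exists_add_mem_mem_orthogonal v
    refine ⟨q, hq, ?_⟩
    have h1 : Y p = 0 := by simpa using hp
    have h2 : Y v = Z x := hv
    rw [← h2, hpq, map_add, h1, zero_add]
  choose g hg hYg using hex
  have huniq : ∀ x w, w ∈ Y.kerᗮ → Y w = Z x → w = g x := by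
    intro x w hw h1
    refine sub_eq_zero.mp (hinj _ (Y.kerᗮ.sub_mem hw (hg x)) ?_)
    rw [map_sub, h1, hYg, sub_self]
  let G : K →ₗ[ℂ] L :=
    { toFun := g
      map_add' := fun x y => (huniq _ _ (Y.kerᗮ.add_mem (hg x) (hg y)) (by simp [hYg])).symm
      map_smul' := fun c x => (huniq _ _ (Y.kerᗮ.smul_mem c (hg x)) (by simp [hYg])).symm }
  have hGc : Continuous G := by
    apply LinearMap.continuous_of_isClosed_graph
    have hset : (G.graph : Set (K × L)) = {p | p.2 ∈ Y.kerᗮ} ∩ {p | Y p.2 = Z p.1} := by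
      ext ⟨x, w⟩
      simp only [SetLike.mem_coe, LinearMap.mem_graph_iff, Set.mem_inter_iff, Set.mem_ofPred_eq]
      constructor
      · intro hw
        change w = g x at hw
        subst hw
        exact ⟨hg x, hYg x⟩
      · rintro ⟨h1, h2⟩
        exact huniq x w h1 h2
    rw [hset]
    refine IsClosed.inter ?_ ?_
    · exact (Submodule.isClosed_orthogonal _).preimage continuous_snd
    · exact isClosed_eq (by fun_prop) (by fun_prop)
  refine ⟨⟨G, hGc⟩, ⟨?_, ?_, ?_⟩, ?_⟩
  · ext x
    exact (hYg x).symm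
  · ext x
    simp only [LinearMap.mem_ker]
    change g x = 0 ↔ Z x = 0
    constructor
    · intro h0
      rw [← hYg, h0, map_zero]
    · intro h0
      exact hinj _ (hg x) (by rw [hYg, h0])
  · rw [← hker]
    rintro _ ⟨x, rfl⟩
    exact hg x
  · rintro D ⟨h1, -, h3⟩
    ext x
    refine huniq x (D x) ?_ ?_
    · rw [hker]
      exact h3 ⟨x, rfl⟩
    · rw [h1]
      rfl

/-- The reduced solution of `Z = Y X`. -/
def reducedSolution (Z : K →L[ℂ] H) (Y : L →L[ℂ] H) (h : Z.range ≤ Y.range) : K →L[ℂ] L :=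
  (existsUnique_reducedSolution Z Y h).choose

theorem reducedSolution_spec (Z : K →L[ℂ] H) (Y : L →L[ℂ] H) (h : Z.range ≤ Y.range) :
    IsReducedSolution Z Y (reducedSolution Z Y h) :=
  (existsUnique_reducedSolution Z Y h).choose_spec.1

/-- The modulus `|T| = (T* T)^{1/2}`. -/
abbrev modulus (T : H →L[ℂ] H) : H →L[ℂ] H := CFC.abs T

/-- `|T|^{1/2}`, the positive square root of the modulus. -/
abbrev sqrtModulus (T : H →L[ℂ] H) : H →L[ℂ] H := CFC.sqrt (CFC.abs T)

/-- A partial isometry is isometric on the orthogonal complement of its nullspace. -/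
def IsPartialIsometry (U : H →L[ℂ] H) : Prop := ∀ x ∈ U.kerᗮ, ‖U x‖ = ‖x‖

/-- `U` is the partial isometry of the polar decomposition `T = U |T|`, `N(U) = N(T)`. -/
structure IsPolarPart (T U : H →L[ℂ] H) : Prop where
  isPartialIsometry : IsPartialIsometry U
  eq : T = U * modulus T
  ker_eq : U.ker = T.ker

theorem norm_modulus_apply (T : H →L[ℂ] H) (x : H) : ‖modulus T x‖ = ‖T x‖ := by
  have h1 : IsSelfAdjoint (modulus T) := IsSelfAdjoint.of_nonneg (CFC.abs_nonneg T)
  have h2 : modulus T * modulus T = star T * T := CFC.abs_mul_abs T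
  have h3 : inner ℂ (modulus T x) (modulus T x) = inner ℂ (T x) (T x) := by
    calc inner ℂ (modulus T x) (modulus T x)
        = inner ℂ ((ContinuousLinearMap.adjoint (modulus T) * modulus T) x) x := by
          rw [mul_apply_eq_comp, ContinuousLinearMap.adjoint_inner_left]
      _ = inner ℂ ((star T * T) x) x := by
          rw [← h2, ← ContinuousLinearMap.star_eq_adjoint, h1.star_eq]
      _ = inner ℂ (T x) (T x) := by
          rw [ContinuousLinearMap.star_eq_adjoint, mul_apply_eq_comp,
            ContinuousLinearMap.adjoint_inner_left]
  rw [inner_self_eq_norm_sq_to_K, inner_self_eq_norm_sq_to_K] at h3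
  have h4 : ‖modulus T x‖ ^ 2 = ‖T x‖ ^ 2 := by exact_mod_cast h3
  exact (sq_eq_sq₀ (norm_nonneg _) (norm_nonneg _)).mp h4

/-- Existence and uniqueness of the polar decomposition. -/
theorem existsUnique_polarPart (T : H →L[ℂ] H) : ∃! U : H →L[ℂ] H, IsPolarPart T U := by
  have hsa : IsSelfAdjoint (modulus T) := IsSelfAdjoint.of_nonneg (CFC.abs_nonneg T)
  let M : Submodule ℂ H := (modulus T).range.topologicalClosure
  have : CompleteSpace M := (Submodule.isClosed_topologicalClosure _).completeSpace_coe
  have hmem : ∀ x, modulus T x ∈ M := fun x => Submodule.le_topologicalClosure _ ⟨x, rfl⟩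
  have hkerM : (modulus T).kerᗮ = M := by
    have := (modulus T).orthogonal_ker
    rw [← ContinuousLinearMap.star_eq_adjoint, hsa.star_eq] at this
    exact this
  have hker : (modulus T).ker = T.ker := by
    ext x
    simp only [LinearMap.mem_ker]
    change modulus T x = 0 ↔ T x = 0
    rw [← norm_eq_zero, norm_modulus_apply, norm_eq_zero]
  have hcl : IsClosed (T.ker : Set H) := T.isClosed_ker
  have : CompleteSpace T.ker := hcl.completeSpace_coe
  have hMo : Mᗮ = T.ker := by
    rw [← hkerM, hker, Submodule.orthogonal_orthogonal]
  let e : H →ₗ[ℂ] M := (modulus T : H →ₗ[ℂ] H).codRestrict M hmem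
  have he : ∀ x, ((e x : M) : H) = modulus T x := fun x => rfl
  have hdense : DenseRange e := by
    intro y
    rw [Metric.mem_closure_iff]
    intro ε hε
    have hy : (y : H) ∈ closure ((modulus T).range : Set H) := y.2
    obtain ⟨_, ⟨x, rfl⟩, hx⟩ := Metric.mem_closure_iff.mp hy ε hε
    exact ⟨e x, ⟨x, rfl⟩, hx⟩
  have hnorm : ∃ C : ℝ, ∀ x, ‖(T : H →ₗ[ℂ] H) x‖ ≤ C * ‖e x‖ := by
    refine ⟨1, fun x => ?_⟩
    rw [one_mul]
    change ‖T x‖ ≤ ‖modulus T x‖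
    rw [norm_modulus_apply]
  let V : M →L[ℂ] H := (T : H →ₗ[ℂ] H).extendOfNorm e
  have hV : ∀ x, V (e x) = T x := fun x => LinearMap.extendOfNorm_eq hdense hnorm x
  have hViso : ∀ y, ‖V y‖ = ‖y‖ := by
    intro y
    have : (fun y : M => ‖V y‖) = fun y => ‖y‖ := by
      refine hdense.equalizer (by fun_prop) (by fun_prop) ?_
      funext x
      change ‖V (e x)‖ = ‖modulus T x‖
      rw [hV, norm_modulus_apply]
    exact congrFun this y
  let U : H →L[ℂ] H := V ∘L M.orthogonalProjectionOnto
  have hU : ∀ y : M, U y = V y := by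
    intro y
    change V (M.orthogonalProjectionOnto y) = V y
    simp
  have hUker : U.ker = T.ker := by
    rw [← hMo]
    ext x
    simp only [LinearMap.mem_ker]
    change V (M.orthogonalProjectionOnto x) = 0 ↔ _
    rw [← norm_eq_zero, hViso, norm_eq_zero]
    simp
  have hUeq : T = U * modulus T := by
    ext x
    change T x = U ((e x : M) : H)
    rw [hU, hV]
  refine ⟨U, ⟨?_, hUeq, hUker⟩, ?_⟩
  · intro x hx
    rw [hUker, ← hMo, Submodule.orthogonal_orthogonal] at hx
    have := hU ⟨x, hx⟩
    change U x = _ at this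
    rw [this, hViso]
    rfl
  · rintro U' ⟨-, h2, h3⟩
    ext x
    obtain ⟨p, hp, q, hq, hpq⟩ := M.exists_add_mem_mem_orthogonal x
    have h4 : ∀ y : M, U' y = V y := by
      have : (fun y : M => U' y) = fun y => V y := by
        refine hdense.equalizer (by fun_prop) (by fun_prop) ?_
        funext x
        change U' (modulus T x) = V (e x)
        rw [hV]
        exact (congrArg (fun A : H →L[ℂ] H => A x) h2).symm
      exact fun y => congrFun this y
    have h5 : U' q = 0 := by
      have : q ∈ U'.ker := by rw [h3, ← hMo]; exact hq
      simpa using this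
    have h6 : U q = 0 := by
      have : q ∈ U.ker := by rw [hUker, ← hMo]; exact hq
      simpa using this
    have h7 := h4 ⟨p, hp⟩
    have h8 := hU ⟨p, hp⟩
    rw [hpq, map_add, map_add, h5, h6]
    change U' p + 0 = U p + 0
    rw [show U' p = _ from h7, show U p = _ from h8]

/-- The partial isometry `U` of the polar decomposition `T = U |T|`. -/
def polarPart (T : H →L[ℂ] H) : H →L[ℂ] H := (existsUnique_polarPart T).choose

theorem polarPart_spec (T : H →L[ℂ] H) : IsPolarPart T (polarPart T) :=
  (existsUnique_polarPart T).choose_spec.1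

end Factorization

section Schur

variable {H : Type*} [NormedAddCommGroup H] [InnerProductSpace ℂ H] [CompleteSpace H]

/-- For `B = [a b; b* c]` with respect to `H = S ⊕ Sᗮ`, the entry `a : S → S`. -/
def blockA (B : H →L[ℂ] H) (S : Submodule ℂ H) [CompleteSpace S] : S →L[ℂ] S :=
  S.orthogonalProjectionOnto ∘L B ∘L S.subtypeL

/-- The entry `b : Sᗮ → S`. -/
def blockB (B : H →L[ℂ] H) (S : Submodule ℂ H) [CompleteSpace S] : Sᗮ →L[ℂ] S :=
  S.orthogonalProjectionOnto ∘L B ∘L Sᗮ.subtypeL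

/-- The entry `c : Sᗮ → Sᗮ`. -/
def blockC (B : H →L[ℂ] H) (S : Submodule ℂ H) [CompleteSpace S] : Sᗮ →L[ℂ] Sᗮ :=
  Sᗮ.orthogonalProjectionOnto ∘L B ∘L Sᗮ.subtypeL

/-- `B` is `S`-weakly complementable if `R(b) ⊆ R(|a|^{1/2})`. -/
def IsWeaklyComplementable (B : H →L[ℂ] H) (S : Submodule ℂ H) [CompleteSpace S] : Prop :=
  (blockB B S).range ≤ (sqrtModulus (blockA B S)).range

/-- The Schur complement `[0 0; 0 c - f* u f]` of an `S`-weakly complementable `B`, where `f` is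
the reduced solution of `b = |a|^{1/2} x` and `a = u |a|` is the polar decomposition of `a`. -/
def schurComplement (B : H →L[ℂ] H) (S : Submodule ℂ H) [CompleteSpace S]
    (h : IsWeaklyComplementable B S) : H →L[ℂ] H :=
  let f : Sᗮ →L[ℂ] S := reducedSolution (blockB B S) (sqrtModulus (blockA B S)) h
  let u : S →L[ℂ] S := polarPart (blockA B S)
  Sᗮ.subtypeL ∘L (blockC B S - ContinuousLinearMap.adjoint f ∘L u ∘L f) ∘L
    Sᗮ.orthogonalProjectionOnto

end Schur

section Unbounded

variable {H : Type*} [NormedAddCommGroup H] [InnerProductSpace ℂ H]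

/-- A bounded everywhere defined operator, as a partially defined one with domain `H`. -/
def ofBounded (T : H →L[ℂ] H) : H →ₗ.[ℂ] H := (T : H →ₗ[ℂ] H).toPMap ⊤

/-- The product `E T` of a partially defined operator with a bounded one, on its natural domain
`{x | T x ∈ Dom(E)}`. -/
def mulBounded (E : H →ₗ.[ℂ] H) (T : H →L[ℂ] H) : H →ₗ.[ℂ] H where
  domain := E.domain.comap (T : H →ₗ[ℂ] H)
  toFun := E.toFun ∘ₗ (T : H →ₗ[ℂ] H).restrict (fun _ hx => hx)

/-- A densely defined projection: `Dom(E)` is dense, `E` maps it into itself, and `E² = E`. -/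
structure IsDenselyDefinedProjection (E : H →ₗ.[ℂ] H) : Prop where
  dense : Dense (E.domain : Set H)
  map_mem : ∀ x : E.domain, E x ∈ E.domain
  idem : ∀ x : E.domain, E ⟨E x, map_mem x⟩ = E x

/-- The nullspace `{x ∈ Dom(E) | E x = 0}`, as a subspace of `H`. -/
def nullspace (E : H →ₗ.[ℂ] H) : Submodule ℂ H := E.toFun.ker.map E.domain.subtype

/-- `A ∈ L(H)`: `A` is everywhere defined and bounded. -/
def IsBoundedOp (A : H →ₗ.[ℂ] H) : Prop := ∃ T : H →L[ℂ] H, A = ofBounded T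

/-- `A ∈ L(H)^s`: `A` is everywhere defined, bounded and selfadjoint. -/
def IsBoundedSelfAdjointOp [CompleteSpace H] (A : H →ₗ.[ℂ] H) : Prop :=
  ∃ T : H →L[ℂ] H, IsSelfAdjoint T ∧ A = ofBounded T

/-- `E` is a densely defined projection with nullspace `Sᗮ` such that
`E |P_S B P_S|^{1/2} ∈ L(H)` and `E B ∈ L(H)^s`. -/
structure IsAdmissibleProjection [CompleteSpace H] (B : H →L[ℂ] H) (S : Submodule ℂ H)
    [CompleteSpace S] (E : H →ₗ.[ℂ] H) : Prop where
  isProjection : IsDenselyDefinedProjection E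
  nullspace_eq : nullspace E = Sᗮ
  bounded : IsBoundedOp
    (mulBounded E (sqrtModulus (S.starProjection * B * S.starProjection)))
  selfAdjoint : IsBoundedSelfAdjointOp (mulBounded E B)

end Unbounded

end WeakSchur

end

/-! Write `P` for the projection onto `S`, `σ = |PBP|^{1/2}`, and `U` for the polar part of `a`
extended by zero. Since `a` is selfadjoint, `U` is a selfadjoint partial isometry commuting with
`σ`, `PBP = σUσ`, and `U²` projects onto the closure of `R(σ)`. Weak complementability amounts to
`PB(1 - P) = σF`, with `F` the extension of the reduced solution `f`; equivalently, `PB = σ(Uσ +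
F)`.

Existence: on the dense domain `R(σ) ⊕ N(σ)` let `E` be `P` on `N(σ)` and `σx ↦ σx + F*Ux` on
`R(σ)`. The added term lies in `Sᗮ`, which `E` kills, so `E² = E`. Substituting `PB = σ(Uσ + F)`
gives `EB = PB + (1 - P)BP + F*UF`, which is bounded and selfadjoint
(`exists_isAdmissibleProjection_of_factorization`).

Converse: let `T = Eσ` and `R = EB`. As `N(E) = Sᗮ`, `E` preserves `S`-components and depends only
on them, so `PR = PB` and `RP = TUσ`. Selfadjointness of `R` turns these into `PB = σUT*`, a
factorization through `σ` (`exists_eq_sqrtModulus_mul`). Comparing it with `σF` gives `F = UT*(1 -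
P)`, which determines `R`, hence `(I - E)B`, whatever `E` is (`mulBounded_one_sub`). -/

noncomputable section

namespace WeakSchur

open ContinuousLinearMap

/-! ### Symmetric polar decomposition of a selfadjoint operator -/

section SignedSquareRoot

variable {H : Type*} [NormedAddCommGroup H] [InnerProductSpace ℂ H] [CompleteSpace H]

/-- `A = s u s` with `s` selfadjoint and `u` a selfadjoint partial isometry which commutes with `s`
and has the same nullspace as `s`. -/
structure IsSignedSqrt (A s u : H →L[ℂ] H) : Prop where
  isSelfAdjoint_sqrt : IsSelfAdjoint s
  isSelfAdjoint_sign : IsSelfAdjoint u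
  commute : u * s = s * u
  sign_sq_mul_sqrt : u * u * s = s
  sign_cube : u * u * u = u
  eq : A = s * u * s
  sign_eq_zero : ∀ x, s x = 0 → u x = 0

/-- An operator vanishing on the range and on the nullspace of a selfadjoint operator is zero. -/
theorem eq_zero_of_mul_eq_zero_of_ker {X p : H →L[ℂ] H} (hp : IsSelfAdjoint p) (h : X * p = 0)
    (hker : ∀ x, p x = 0 → X x = 0) : X = 0 := by
  have hle : p.range ≤ X.ker := by
    rintro _ ⟨x, rfl⟩
    exact congr($h x)
  have hcl : p.range.topologicalClosure ≤ X.ker :=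
    Submodule.topologicalClosure_minimal _ hle X.isClosed_ker
  have horth : p.kerᗮ = p.range.topologicalClosure := by
    have := p.orthogonal_ker
    rwa [← star_eq_adjoint, hp.star_eq] at this
  have : CompleteSpace p.ker := p.isClosed_ker.completeSpace_coe
  ext x
  obtain ⟨y, hy, z, hz, rfl⟩ := p.ker.exists_add_mem_mem_orthogonal x
  rw [horth] at hz
  rw [map_add, hker y hy, show X z = 0 from hcl hz]
  simp

/-- The C*-identity applies, because `(Xs)(Xs)* = X s² X*`. -/
theorem mul_eq_zero_of_mul_mul_self_eq_zero {X s : H →L[ℂ] H} (hs : IsSelfAdjoint s)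
    (h : X * (s * s) = 0) : X * s = 0 := by
  rw [← CStarRing.mul_star_self_eq_zero_iff, star_mul, hs.star_eq]
  calc X * s * (s * star X) = X * (s * s) * star X := by simp only [mul_assoc]
    _ = 0 := by rw [h, zero_mul]

theorem modulus_nonneg (T : H →L[ℂ] H) : 0 ≤ modulus T := CFC.abs_nonneg T

theorem modulus_mul_self (T : H →L[ℂ] H) : modulus T * modulus T = star T * T :=
  CFC.abs_mul_abs T

theorem sqrtModulus_nonneg (T : H →L[ℂ] H) : 0 ≤ sqrtModulus T := CFC.sqrt_nonneg _

theorem isSelfAdjoint_sqrtModulus (T : H →L[ℂ] H) : IsSelfAdjoint (sqrtModulus T) :=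
  IsSelfAdjoint.of_nonneg (sqrtModulus_nonneg T)

theorem sqrtModulus_mul_self (T : H →L[ℂ] H) : sqrtModulus T * sqrtModulus T = modulus T :=
  CFC.sqrt_mul_sqrt_self _ (CFC.abs_nonneg T)

/-- The polar decomposition of a selfadjoint operator, in symmetric form. -/
theorem isSignedSqrt_polarPart {a : H →L[ℂ] H} (ha : IsSelfAdjoint a) :
    IsSignedSqrt a (sqrtModulus a) (polarPart a) := by
  obtain ⟨-, hau, hker⟩ := polarPart_spec a
  set u := polarPart a
  set s := sqrtModulus a with hs_def
  set p := modulus a with hp_def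
  have hs : IsSelfAdjoint s := isSelfAdjoint_sqrtModulus a
  have hp : IsSelfAdjoint p := IsSelfAdjoint.of_nonneg (CFC.abs_nonneg a)
  have hss : s * s = p := sqrtModulus_mul_self a
  have hu0 : ∀ x, p x = 0 → u x = 0 := by
    intro x hx
    have hax : a x = 0 := by rw [← norm_eq_zero, ← norm_modulus_apply, norm_eq_zero]; exact hx
    have : x ∈ u.ker := hker ▸ hax
    exact this
  have hpa : p * a = a * p := CFC.commute_abs_self a ha.isStarNormal
  -- Both sides vanish on `N(p)`, and on `R(p)` they agree because `|a|` commutes with `a = u|a|`.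
  have hup : u * p = p * u := by
    refine sub_eq_zero.mp (eq_zero_of_mul_eq_zero_of_ker hp ?_ fun x hx => ?_)
    · rw [sub_mul, ← hau, mul_assoc p, ← hau, hpa, sub_self]
    · simp [hx, hu0 x hx]
  have hpu' : p * star u = a := by
    have := congrArg star hau
    rwa [star_mul, hp.star_eq, ha.star_eq, eq_comm] at this
  have hu : IsSelfAdjoint u := by
    refine (sub_eq_zero.mp (eq_zero_of_mul_eq_zero_of_ker hp (X := u - star u) ?_
      fun x hx => ?_)).symm
    · have h1 : p * (star u - u) = 0 := by rw [mul_sub, hpu', ← hup, ← hau, sub_self]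
      simpa [hp.star_eq] using congrArg star h1
    -- For `x ∈ N(p)`, `p u* x = a x = u p x = 0`, so `u* x ∈ N(p) ⊆ N(u)` and `‖u* x‖² = ⟨x, u u*
    -- x⟩ = 0`.
    · have h1 : p (star u x) = 0 := by
        have := congr($hpu' x)
        rw [hau] at this
        simpa [hx] using this
      have h2 : star u x = 0 := by
        rw [← inner_self_eq_zero (𝕜 := ℂ)]
        conv_lhs => rw [star_eq_adjoint, adjoint_inner_left]
        rw [← star_eq_adjoint, hu0 _ h1, inner_zero_right]
      simp [hu0 x hx, h2]
  have huup : (u * u - 1) * p = 0 := by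
    refine mul_eq_zero_of_mul_mul_self_eq_zero hp ?_
    have h1 : p * p = star a * a := modulus_mul_self a
    rw [sub_mul, one_mul, sub_eq_zero]
    -- `u²p² = (up)² = a² = a*a = p²`.
    calc u * u * (p * p) = u * (u * p) * p := by simp only [mul_assoc]
      _ = (u * p) * (u * p) := by rw [hup, ← mul_assoc u p u, hup, mul_assoc, hup]
      _ = p * p := by rw [← hau, h1, ha.star_eq]
  have hcomm : u * s = s * u := by
    have : Commute p u := hup.symm
    exact (Commute.cfcₙ_nnreal this _).symm
  refine ⟨hs, hu, hcomm, ?_, ?_, ?_, fun x hx => hu0 x ?_⟩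
  · rw [← hss] at huup
    have := mul_eq_zero_of_mul_mul_self_eq_zero hs huup
    rwa [sub_mul, one_mul, sub_eq_zero] at this
  · refine sub_eq_zero.mp (eq_zero_of_mul_eq_zero_of_ker hp ?_ fun x hx => ?_)
    · calc (u * u * u - u) * p = (u * u - 1) * (u * p) := by noncomm_ring
        _ = 0 := by rw [hup, ← mul_assoc, huup, zero_mul]
    · simp [hu0 x hx]
  · rw [← hcomm, mul_assoc, hss]
    exact hau
  · rw [← hss]
    simp [hx]

end SignedSquareRoot

/-! ### Passing from operators on `S` to operators on `H` -/

section Compression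

variable {H : Type*} [NormedAddCommGroup H] [InnerProductSpace ℂ H]
  (S : Submodule ℂ H) [CompleteSpace S]

/-- The extension of an operator on `S` to `H = S ⊕ Sᗮ` by zero on `Sᗮ`. -/
def extendByZero (T : S →L[ℂ] S) : H →L[ℂ] H :=
  S.subtypeL ∘L T ∘L S.orthogonalProjectionOnto

theorem extendByZero_apply (T : S →L[ℂ] S) (x : H) :
    extendByZero S T x = T (S.orthogonalProjectionOnto x) := rfl

theorem extendByZero_mul (T R : S →L[ℂ] S) :
    extendByZero S (T * R) = extendByZero S T * extendByZero S R := by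
  ext x
  simp [extendByZero_apply]

theorem starProjection_mul_extendByZero (T : S →L[ℂ] S) :
    S.starProjection * extendByZero S T = extendByZero S T := by
  ext x
  simp [extendByZero_apply, Submodule.starProjection_apply]

theorem extendByZero_blockA (B : H →L[ℂ] H) :
    extendByZero S (blockA B S) = S.starProjection * B * S.starProjection := rfl

variable [CompleteSpace H]

theorem star_extendByZero (T : S →L[ℂ] S) :
    star (extendByZero S T) = extendByZero S (star T) := by
  simp only [extendByZero, star_eq_adjoint, adjoint_comp, Submodule.adjoint_subtypeL,
    Submodule.adjoint_orthogonalProjectionOnto, comp_assoc]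

theorem extendByZero_nonneg {T : S →L[ℂ] S} (h : 0 ≤ T) : 0 ≤ extendByZero S T := by
  rw [nonneg_iff_isPositive] at h ⊢
  have := h.conj_adjoint S.subtypeL
  rwa [Submodule.adjoint_subtypeL] at this

/-- Extension by zero is multiplicative, compatible with adjoints and preserves positivity, so
uniqueness of positive square roots applies twice. This links `|a|^{1/2}` on `S` to `|PBP|^{1/2}` on
`H`. -/
theorem sqrtModulus_extendByZero (T : S →L[ℂ] S) :
    sqrtModulus (extendByZero S T) = extendByZero S (sqrtModulus T) := by
  have habs : modulus (extendByZero S T) = extendByZero S (modulus T) := by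
    refine CFC.sqrt_unique ?_ (extendByZero_nonneg S (modulus_nonneg T))
    rw [← extendByZero_mul, modulus_mul_self, extendByZero_mul, star_extendByZero]
  refine CFC.sqrt_unique ?_ (extendByZero_nonneg S (sqrtModulus_nonneg T))
  rw [← extendByZero_mul, sqrtModulus_mul_self]
  exact habs.symm

theorem IsSignedSqrt.extendByZero {a s u : S →L[ℂ] S} (h : IsSignedSqrt a s u) :
    IsSignedSqrt (extendByZero S a) (extendByZero S s) (extendByZero S u) where
  isSelfAdjoint_sqrt := by
    rw [IsSelfAdjoint, star_extendByZero, h.isSelfAdjoint_sqrt.star_eq]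
  isSelfAdjoint_sign := by
    rw [IsSelfAdjoint, star_extendByZero, h.isSelfAdjoint_sign.star_eq]
  commute := by rw [← extendByZero_mul, h.commute, extendByZero_mul]
  sign_sq_mul_sqrt := by rw [← extendByZero_mul, ← extendByZero_mul, h.sign_sq_mul_sqrt]
  sign_cube := by rw [← extendByZero_mul, ← extendByZero_mul, h.sign_cube]
  eq := by rw [← extendByZero_mul, ← extendByZero_mul, ← h.eq]
  sign_eq_zero x hx := by
    rw [extendByZero_apply, ZeroMemClass.coe_eq_zero] at hx ⊢
    exact h.sign_eq_zero _ hx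

theorem isSelfAdjoint_blockA {B : H →L[ℂ] H} (hB : IsSelfAdjoint B) :
    IsSelfAdjoint (blockA B S) := by
  rw [IsSelfAdjoint, blockA, star_eq_adjoint, adjoint_comp, adjoint_comp,
    Submodule.adjoint_subtypeL, Submodule.adjoint_orthogonalProjectionOnto, ← star_eq_adjoint,
    hB.star_eq, comp_assoc]

end Compression

/-! ### Partially defined operators and projections with nullspace `Sᗮ` -/

section PartialOperators

variable {H : Type*} [NormedAddCommGroup H] [InnerProductSpace ℂ H]

theorem mulBounded_eq_ofBounded_iff {E : H →ₗ.[ℂ] H} {T R : H →L[ℂ] H} :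
    mulBounded E T = ofBounded R ↔ ∀ x, ∃ h : T x ∈ E.domain, E ⟨T x, h⟩ = R x := by
  constructor
  · intro h x
    obtain ⟨hd, hv⟩ := LinearPMap.ext_iff.mp h
    have hx : x ∈ (mulBounded E T).domain := by rw [hd]; trivial
    exact ⟨hx, hv (hf := hx) (hg := trivial)⟩
  · intro h
    refine LinearPMap.ext ?_ fun x _ _ => (h x).2
    ext x
    exact ⟨fun _ => trivial, fun _ => (h x).1⟩

theorem mem_nullspace_iff {E : H →ₗ.[ℂ] H} {x : H} :
    x ∈ nullspace E ↔ ∃ h : x ∈ E.domain, E ⟨x, h⟩ = 0 := by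
  simp only [nullspace, Submodule.mem_map, LinearMap.mem_ker, Submodule.subtype_apply,
    Subtype.exists, exists_and_right, exists_eq_right]
  rfl

/-- The operator `L x ↦ M x` on the range of an injective operator `L`. -/
def quotientOp (L M : H →L[ℂ] H) (hL : Function.Injective L) : H →ₗ.[ℂ] H where
  domain := L.range
  toFun := (M : H →ₗ[ℂ] H) ∘ₗ (LinearEquiv.ofInjective (L : H →ₗ[ℂ] H) hL).symm.toLinearMap

theorem quotientOp_apply {L M : H →L[ℂ] H} (hL : Function.Injective L) {x y : H} (h : L x = y)
    (hy : y ∈ (quotientOp L M hL).domain) : quotientOp L M hL ⟨y, hy⟩ = M x := by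
  subst h
  change M ((LinearEquiv.ofInjective (L : H →ₗ[ℂ] H) hL).symm
    (LinearEquiv.ofInjective (L : H →ₗ[ℂ] H) hL x)) = M x
  rw [LinearEquiv.symm_apply_apply]

/-- A densely defined projection with nullspace `Sᗮ` preserves the component in `S`. -/
theorem IsDenselyDefinedProjection.starProjection_apply {E : H →ₗ.[ℂ] H}
    (hE : IsDenselyDefinedProjection E) {S : Submodule ℂ H} [CompleteSpace S]
    (hS : nullspace E = Sᗮ) (x : E.domain) : S.starProjection (E x) = S.starProjection x := by
  have h : (x : H) - E x ∈ nullspace E := by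
    refine mem_nullspace_iff.mpr ⟨E.domain.sub_mem x.2 (hE.map_mem x), ?_⟩
    have h1 := E.map_sub x ⟨E x, hE.map_mem x⟩
    rw [hE.idem, sub_self] at h1
    exact h1
  rw [hS, ← Submodule.starProjection_apply_eq_zero_iff, map_sub, sub_eq_zero] at h
  exact h.symm

/-- A partially defined operator with nullspace `Sᗮ` depends only on the component in `S`. -/
theorem exists_apply_starProjection {E : H →ₗ.[ℂ] H} {S : Submodule ℂ H} [CompleteSpace S]
    (hS : nullspace E = Sᗮ) (x : E.domain) :
    ∃ h : S.starProjection (x : H) ∈ E.domain, E ⟨S.starProjection (x : H), h⟩ = E x := by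
  have h : (x : H) - S.starProjection (x : H) ∈ nullspace E := by
    rw [hS]
    exact S.sub_starProjection_mem_orthogonal _
  obtain ⟨hd, h0⟩ := mem_nullspace_iff.mp h
  have hmem : S.starProjection (x : H) ∈ E.domain := by
    simpa using E.domain.sub_mem x.2 hd
  refine ⟨hmem, ?_⟩
  have h1 := E.map_sub x ⟨S.starProjection (x : H), hmem⟩
  rw [show (x - ⟨S.starProjection (x : H), hmem⟩ : E.domain) = ⟨_, hd⟩ from rfl, h0] at h1
  exact (sub_eq_zero.mp h1.symm).symm

end PartialOperators

/-! ### Admissible projections and factorizations through `σ` -/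

section Factorization

variable {H : Type*} [NormedAddCommGroup H] [InnerProductSpace ℂ H] [CompleteSpace H]

/-- The factorization `P B (1 - P) = σ F` behind weak complementability, where `P B P = σ U σ`. -/
structure IsWeakFactorization (P B σ U F : H →L[ℂ] H) : Prop where
  signedSqrt : IsSignedSqrt (P * B * P) σ U
  proj_mul_sqrt : P * σ = σ
  proj_mul_sign : P * U = U
  factor_mul_proj : F * P = 0
  eq : P * B * (1 - P) = σ * F
  sign_sq_mul_factor : U * U * F = F

/-- The projection is `L x ↦ M x`, which avoids inverting `σ`: `L` is `σ` on the closure of `R(σ)`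
and the identity on `N(σ)`. -/
theorem exists_isAdmissibleProjection_of_factorization {B σ U F : H →L[ℂ] H} {S : Submodule ℂ H}
    [CompleteSpace S] (hB : IsSelfAdjoint B)
    (h : IsWeakFactorization S.starProjection B σ U F)
    (hσ : sqrtModulus (S.starProjection * B * S.starProjection) = σ) :
    ∃ E : H →ₗ.[ℂ] H, IsAdmissibleProjection B S E := by
  obtain ⟨⟨hσsa, hUsa, hcomm, hUUσ, hUUU, hA, hker⟩, hPσ, hPU, hFP, hfac, hUUF⟩ := h
  have hP : star S.starProjection = S.starProjection :=
    (isSelfAdjoint_starProjection S).star_eq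
  have mem_iff : ∀ y, y ∈ Sᗮ ↔ S.starProjection y = 0 := fun y =>
    (Submodule.starProjection_apply_eq_zero_iff S).symm
  have hPP : S.starProjection * S.starProjection = S.starProjection :=
    S.isIdempotentElem_starProjection
  set P := S.starProjection
  have hσP : σ * P = σ := by simpa [hP, hσsa.star_eq] using congrArg star hPσ
  have hUP : U * P = U := by simpa [hP, hUsa.star_eq] using congrArg star hPU
  have hσUU : σ * (U * U) = σ := by
    simpa [hσsa.star_eq, hUsa.star_eq] using congrArg star hUUσ
  have hGP : P * star F = 0 := by simpa [hP] using congrArg star hFP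
  have hσG : σ * star F = 0 := by rw [← hσP, mul_assoc, hGP, mul_zero]
  have hUG : U * star F = 0 := by rw [← hUP, mul_assoc, hGP, mul_zero]
  have eσP (x) : σ (P x) = σ x := congr($hσP x)
  have ePσ (x) : P (σ x) = σ x := congr($hPσ x)
  have eUP (x) : U (P x) = U x := congr($hUP x)
  have ePU (x) : P (U x) = U x := congr($hPU x)
  have ePP (x) : P (P x) = P x := congr($hPP x)
  have eUUσ (x) : U (U (σ x)) = σ x := congr($hUUσ x)
  have eσUU (x) : σ (U (U x)) = σ x := congr($hσUU x)
  have eUUU (x) : U (U (U x)) = U x := congr($hUUU x)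
  have ePG (x) : P (star F x) = 0 := congr($hGP x)
  have eσG (x) : σ (star F x) = 0 := congr($hσG x)
  have eUG (x) : U (star F x) = 0 := congr($hUG x)
  let L : H →L[ℂ] H := σ + 1 - U * U
  let M : H →L[ℂ] H := σ + star F * U + P - U * U
  have eL (x) : L x = σ x + x - U (U x) := rfl
  have eM (x) : M x = σ x + star F (U x) + P x - U (U x) := rfl
  -- `U²L = σ`, so `L x = 0` forces `σx = 0`, then `U x = 0`, and `L x` reduces to `x`.
  have hL0 : ∀ x, L x = 0 → x = 0 := by
    intro x hx
    have h1 : U (U (L x)) = 0 := by rw [hx]; simp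
    have h2 : σ x = 0 := by simpa [eL, eUUσ, eUUU] using h1
    simpa [eL, h2, hker x h2] using hx
  have hL : Function.Injective L := (injective_iff_map_eq_zero L).mpr hL0
  have hLsa : star L = L := by
    simp [L, hσsa.star_eq, hUsa.star_eq]
  have hdom : ∀ x, L x ∈ (quotientOp L M hL).domain := fun x => ⟨x, rfl⟩
  have hval : ∀ {x y : H}, L x = y → ∃ hy : y ∈ (quotientOp L M hL).domain,
      quotientOp L M hL ⟨y, hy⟩ = M x := fun {x y} hxy =>
    ⟨hxy ▸ hdom x, quotientOp_apply hL hxy _⟩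
  have hLM (x) : L (P x + star F (U x)) = M x := by
    simp [eL, eM, eσP, eσG, eUP, eUG]; abel
  have hMM (x) : M (P x + star F (U x)) = M x := by
    simp [eM, eσP, eσG, eUP, eUG, ePP, ePG]
  have hEσ : mulBounded (quotientOp L M hL) σ = ofBounded (σ + star F * U) := by
    refine mulBounded_eq_ofBounded_iff.mpr fun x => ?_
    obtain ⟨h1, h2⟩ := hval (x := U (U x)) (y := σ x) (by simp [eL, eσUU, eUUU])
    refine ⟨h1, h2.trans ?_⟩
    simp [eM, eσUU, eUUU, ePU]
  have hPB : P * B = σ * (U * σ + F) := by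
    rw [mul_add, ← hfac, ← mul_assoc, ← hA]; noncomm_ring
  have hBP : (1 - P) * B * P = star F * σ := by
    simpa [hP, hB.star_eq, hσsa.star_eq, mul_assoc] using congrArg star hfac
  have hEB : mulBounded (quotientOp L M hL) B =
      ofBounded (P * B + (1 - P) * B * P + star F * U * F) := by
    refine mulBounded_eq_ofBounded_iff.mpr fun x => ?_
    have e1 (x) : P (B x) = σ (U (σ x) + F x) := congr($hPB x)
    have e2 : ((1 - P) * B * P) x = star F (σ x) := congr($hBP x)
    have e3 : U (U (F x)) = F x := congr($hUUF x)
    set y := B x - P (B x) with hy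
    have hPy : P y = 0 := by simp [hy, ePP]
    have hσy : σ y = 0 := by rw [← eσP, hPy, map_zero]
    have hUy : U y = 0 := by rw [← eUP, hPy, map_zero]
    -- The preimage of `B x = σ(Uσx + Fx) + y`: `L U² = σ`, and `L` fixes `y ∈ Sᗮ`, which `M` kills.
    obtain ⟨h1, h2⟩ := hval (x := U (U (U (σ x) + F x)) + y) (y := B x) (by
      rw [map_add, eL, eL, hσy, hUy, eσUU, eUUU, ← e1, hy]; simp)
    refine ⟨h1, h2.trans ?_⟩
    change _ = P (B x) + ((1 - P) * B * P) x + star F (U (F x))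
    rw [e2, e1, map_add, eM, eM, hσy, hUy, hPy, eσUU, eUUU, ePU]
    simp only [map_add, map_zero, eUUσ, e3, add_zero]
    abel
  have hRsa : IsSelfAdjoint (P * B + (1 - P) * B * P + star F * U * F) := by
    rw [IsSelfAdjoint]
    simp only [star_add, star_mul, star_sub, star_one, hP, hB.star_eq, hUsa.star_eq, star_star]
    noncomm_ring
  refine ⟨quotientOp L M hL, ⟨?_, ?_, ?_⟩, ?_, hσ ▸ ⟨_, hEσ⟩, _, hRsa, hEB⟩
  · change Dense (L.range : Set H)
    -- An injective selfadjoint operator has dense range.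
    rw [Submodule.dense_iff_topologicalClosure_eq_top, Submodule.topologicalClosure_eq_top_iff,
      orthogonal_range, ← star_eq_adjoint, hLsa, eq_bot_iff]
    exact fun x hx => hL0 x hx
  · rintro ⟨_, x, rfl⟩
    exact ⟨_, (hLM x).trans (quotientOp_apply hL rfl _).symm⟩
  · rintro ⟨_, x, rfl⟩
    have h1 : quotientOp L M hL ⟨_, x, rfl⟩ = M x := quotientOp_apply hL rfl _
    rw [quotientOp_apply hL ((hLM x).trans h1.symm), h1, hMM]
  · ext y
    rw [mem_nullspace_iff, mem_iff]
    constructor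
    · rintro ⟨⟨x, rfl⟩, h0⟩
      have h1 : M x = 0 := (quotientOp_apply hL rfl _).symm.trans h0
      -- `PM = PL`, so `M x = 0` puts `L x` in `Sᗮ`.
      have h2 := congrArg P h1
      change P (L x) = 0
      simpa [eM, eL, ePσ, ePG, ePP, ePU] using h2
    · intro hy
      have hσy : σ y = 0 := by rw [← eσP, hy, map_zero]
      have hUy : U y = 0 := by rw [← eUP, hy, map_zero]
      obtain ⟨h1, h2⟩ := hval (x := y) (y := y) (by simp [eL, hσy, hUy])
      exact ⟨h1, h2.trans (by simp [eM, hσy, hUy, hy])⟩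

/-- The compressions of the bounded operators `T = E σ` and `R = E B` attached to a projection. -/
theorem IsAdmissibleProjection.exists_bounded {B : H →L[ℂ] H} {S : Submodule ℂ H}
    [CompleteSpace S] {E : H →ₗ.[ℂ] H} (hE : IsAdmissibleProjection B S E) :
    ∃ T R : H →L[ℂ] H, IsSelfAdjoint R ∧ mulBounded E B = ofBounded R ∧
      S.starProjection * R = S.starProjection * B ∧
      ∀ X Y : H →L[ℂ] H, S.starProjection * B * Y =
        sqrtModulus (S.starProjection * B * S.starProjection) * X → R * Y = T * X := by
  obtain ⟨hproj, hnull, ⟨T, hT⟩, R, hR, hEB⟩ := hE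
  rw [mulBounded_eq_ofBounded_iff] at hT
  have hEB' := mulBounded_eq_ofBounded_iff.mp hEB
  refine ⟨T, R, hR, hEB, ?_, fun X Y hXY => ?_⟩
  · ext x
    obtain ⟨h1, h2⟩ := hEB' x
    have := hproj.starProjection_apply hnull ⟨B x, h1⟩
    rw [h2] at this
    exact this
  · ext x
    obtain ⟨h1, h2⟩ := hEB' (Y x)
    obtain ⟨h3, h4⟩ := hT (X x)
    obtain ⟨h5, h6⟩ := exists_apply_starProjection hnull ⟨B (Y x), h1⟩
    have h7 : S.starProjection (B (Y x)) = _ := congr($hXY x)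
    change R (Y x) = T (X x)
    rw [← h2, ← h4, ← h6]
    congr 1
    exact Subtype.ext h7

theorem IsAdmissibleProjection.exists_eq_sqrtModulus_mul {B U : H →L[ℂ] H} {S : Submodule ℂ H}
    [CompleteSpace S] {E : H →ₗ.[ℂ] H} (hE : IsAdmissibleProjection B S E)
    (h : IsSignedSqrt (S.starProjection * B * S.starProjection)
      (sqrtModulus (S.starProjection * B * S.starProjection)) U) :
    ∃ X, S.starProjection * B =
      sqrtModulus (S.starProjection * B * S.starProjection) * X := by
  obtain ⟨T, R, hR, -, hPR, hRY⟩ := hE.exists_bounded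
  have hP : star S.starProjection = S.starProjection :=
    (isSelfAdjoint_starProjection S).star_eq
  -- `PBP = σ(Uσ)` yields `RP = TUσ`; the adjoint is `PB = PR = σUT*`.
  have h1 := congrArg star (hRY (U * sqrtModulus (S.starProjection * B * S.starProjection))
    S.starProjection (by rw [← mul_assoc]; exact h.eq))
  rw [star_mul, star_mul, star_mul, hP, hR.star_eq, h.isSelfAdjoint_sqrt.star_eq, hPR] at h1
  exact ⟨_, h1.trans (mul_assoc _ _ _)⟩

/-- For an admissible projection `E`, the operator `(1 - E) B` in terms of a factorization. -/
theorem IsAdmissibleProjection.mulBounded_one_sub {B U F : H →L[ℂ] H} {S : Submodule ℂ H}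
    [CompleteSpace S] (hB : IsSelfAdjoint B) {E : H →ₗ.[ℂ] H} (hE : IsAdmissibleProjection B S E)
    (h : IsWeakFactorization S.starProjection B
      (sqrtModulus (S.starProjection * B * S.starProjection)) U F) :
    mulBounded (ofBounded (ContinuousLinearMap.id ℂ H) - E) B =
      ofBounded ((1 - S.starProjection) * B * (1 - S.starProjection) - star F * U * F) := by
  obtain ⟨T, R, hR, hEB, hPR, hRY⟩ := hE.exists_bounded
  obtain ⟨⟨hσsa, hUsa, hcomm, hUUσ, hUUU, hA, hker⟩, hPσ, hPU, hFP, hfac, hUUF⟩ := h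
  have hP : star S.starProjection = S.starProjection :=
    (isSelfAdjoint_starProjection S).star_eq
  set P := S.starProjection
  set σ := sqrtModulus (P * B * P)
  have hRP : R * P = B * P := by
    simpa [hP, hB.star_eq, hR.star_eq] using congrArg star hPR
  have hRP' : R * P = T * (U * σ) := hRY _ _ (by rw [← mul_assoc]; exact hA)
  have hPB : P * B = σ * (U * star T) := by
    have := congrArg star (hRP.symm.trans hRP')
    simpa [hP, hB.star_eq, hσsa.star_eq, hUsa.star_eq, mul_assoc] using this
  -- The two factorizations differ by an operator into `N(σ) ⊆ N(U)`; multiplying by `U` once more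
  -- recovers `F`, since `U²F = F` and `U³ = U`.
  have hF : F = U * star T * (1 - P) := by
    have h1 : σ * (F - U * star T * (1 - P)) = 0 := by
      rw [mul_sub, ← hfac, hPB]; simp only [mul_assoc, sub_self]
    have h2 : U * (F - U * star T * (1 - P)) = 0 := by
      ext x
      exact hker _ congr($h1 x)
    have h3 : U * (U * F) = U * (U * (U * star T * (1 - P))) := by
      rw [mul_sub, sub_eq_zero] at h2
      rw [h2]
    rw [← mul_assoc, hUUF, ← mul_assoc, ← mul_assoc, ← mul_assoc, hUUU] at h3
    exact h3
  have hFs : star F = (1 - P) * T * U := by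
    rw [hF]; simp [hP, hUsa.star_eq, mul_assoc]
  have hRF : R * (1 - P) = T * F := hRY _ _ hfac
  have hkey : (1 - P) * R * (1 - P) = star F * U * F := by
    rw [mul_assoc, hRF, hFs]
    calc (1 - P) * (T * F) = (1 - P) * (T * (U * U * F)) := by rw [hUUF]
      _ = _ := by simp only [mul_assoc]
  have hBR : (1 - P) * B * (1 - P) - star F * U * F = B - R := by
    have e : ∀ X : H →L[ℂ] H, (1 - P) * X * (1 - P) = X - P * X - X * P + P * (X * P) := by
      intro X; noncomm_ring
    rw [← hkey, e, e, hRP, hPR]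
    abel
  rw [hBR]
  rw [mulBounded_eq_ofBounded_iff] at hEB ⊢
  intro x
  obtain ⟨h1, h2⟩ := hEB x
  refine ⟨⟨trivial, h1⟩, ?_⟩
  rw [LinearPMap.sub_apply]
  change B x - E ⟨B x, _⟩ = B x - R x
  rw [h2]

end Factorization

section WeaklyComplementable

variable {H : Type*} [NormedAddCommGroup H] [InnerProductSpace ℂ H] [CompleteSpace H]
  (S : Submodule ℂ H) [CompleteSpace S]

theorem isSignedSqrt_compression {B : H →L[ℂ] H} (hB : IsSelfAdjoint B) :
    IsSignedSqrt (S.starProjection * B * S.starProjection)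
      (sqrtModulus (S.starProjection * B * S.starProjection))
      (extendByZero S (polarPart (blockA B S))) := by
  rw [← extendByZero_blockA, sqrtModulus_extendByZero]
  exact (isSignedSqrt_polarPart (isSelfAdjoint_blockA S hB)).extendByZero S

theorem isWeakFactorization_reducedSolution {B : H →L[ℂ] H} (hB : IsSelfAdjoint B)
    (h : IsWeaklyComplementable B S) :
    IsWeakFactorization S.starProjection B
      (sqrtModulus (S.starProjection * B * S.starProjection))
      (extendByZero S (polarPart (blockA B S)))
      (S.subtypeL ∘L reducedSolution (blockB B S) (sqrtModulus (blockA B S)) h ∘L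
        Sᗮ.orthogonalProjectionOnto) := by
  obtain ⟨hf, -, hrange⟩ := reducedSolution_spec (blockB B S) (sqrtModulus (blockA B S)) h
  set f := reducedSolution (blockB B S) (sqrtModulus (blockA B S)) h
  have hu := isSignedSqrt_polarPart (isSelfAdjoint_blockA S hB)
  have hsq := sqrtModulus_extendByZero S (blockA B S)
  rw [extendByZero_blockA] at hsq
  refine ⟨isSignedSqrt_compression S hB, ?_, starProjection_mul_extendByZero S _, ?_, ?_, ?_⟩
  · rw [hsq, starProjection_mul_extendByZero]
  · ext x
    have : Sᗮ.orthogonalProjectionOnto (S.starProjection x) = 0 := by simp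
    simp [this]
  · rw [hsq]
    ext x
    have h1 := congrArg Subtype.val (congr($hf (Sᗮ.orthogonalProjectionOnto x)))
    have h2 : ((Sᗮ.orthogonalProjectionOnto x : Sᗮ) : H) = x - S.starProjection x := by
      rw [← Submodule.starProjection_apply, Submodule.starProjection_orthogonal_val]
    change ((S.orthogonalProjectionOnto (B (Sᗮ.orthogonalProjectionOnto x : Sᗮ)) : S) : H) = _ at h1
    change ((S.orthogonalProjectionOnto (B (x - S.starProjection x)) : S) : H) = _
    rw [← h2, h1, mul_apply_eq_comp, extendByZero_apply]
    simp
  · have hle : f.range ≤ (polarPart (blockA B S) * polarPart (blockA B S) - 1).ker := by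
      refine hrange.trans (Submodule.topologicalClosure_minimal _ ?_ (isClosed_ker _))
      rw [← star_eq_adjoint, hu.isSelfAdjoint_sqrt.star_eq]
      rintro _ ⟨x, rfl⟩
      have := congr($(hu.sign_sq_mul_sqrt) x)
      exact sub_eq_zero.mpr this
    ext x
    have h1 := LinearMap.mem_ker.mp (hle ⟨Sᗮ.orthogonalProjectionOnto x, rfl⟩)
    have h2 := congrArg Subtype.val (sub_eq_zero.mp h1)
    rw [← extendByZero_mul, mul_apply_eq_comp, extendByZero_apply]
    simpa using h2

theorem schurComplement_eq (B : H →L[ℂ] H) (h : IsWeaklyComplementable B S) :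
    schurComplement B S h = (1 - S.starProjection) * B * (1 - S.starProjection) -
      star (S.subtypeL ∘L reducedSolution (blockB B S) (sqrtModulus (blockA B S)) h ∘L
          Sᗮ.orthogonalProjectionOnto) * extendByZero S (polarPart (blockA B S)) *
        (S.subtypeL ∘L reducedSolution (blockB B S) (sqrtModulus (blockA B S)) h ∘L
          Sᗮ.orthogonalProjectionOnto) := by
  have h1 : 1 - S.starProjection = Sᗮ.starProjection := S.starProjection_orthogonal'.symm
  rw [h1, star_eq_adjoint, adjoint_comp, adjoint_comp, Submodule.adjoint_subtypeL,
    Submodule.adjoint_orthogonalProjectionOnto]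
  ext x
  simp [schurComplement, blockC, extendByZero_apply]
  abel

theorem isWeaklyComplementable_of_eq_mul {B X : H →L[ℂ] H}
    (h : S.starProjection * B =
      sqrtModulus (S.starProjection * B * S.starProjection) * X) :
    IsWeaklyComplementable B S := by
  have hsq := sqrtModulus_extendByZero S (blockA B S)
  rw [extendByZero_blockA] at hsq
  rw [hsq] at h
  rintro _ ⟨x, rfl⟩
  refine ⟨S.orthogonalProjectionOnto (X x), Subtype.ext ?_⟩
  exact congr($h.symm (x : H))

end WeaklyComplementable

end WeakSchur

end

/-- Completeness of `S` says that `S` is a closed subspace of the Hilbert space `H`. The formula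
for the Schur complement is an equality of operators including their domains: `(I - E) B` is
everywhere defined, and it holds for every projection `E` as in the equivalence. -/
theorem theorem3p14 {H : Type*} [NormedAddCommGroup H] [InnerProductSpace ℂ H] [CompleteSpace H]
    (B : H →L[ℂ] H) (hB : IsSelfAdjoint B) (S : Submodule ℂ H) [CompleteSpace S] :
    (WeakSchur.IsWeaklyComplementable B S ↔
      ∃ E : H →ₗ.[ℂ] H, WeakSchur.IsAdmissibleProjection B S E) ∧
    ∀ (h : WeakSchur.IsWeaklyComplementable B S) (E : H →ₗ.[ℂ] H),
      WeakSchur.IsAdmissibleProjection B S E →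
        WeakSchur.ofBounded (WeakSchur.schurComplement B S h) =
          WeakSchur.mulBounded (WeakSchur.ofBounded (ContinuousLinearMap.id ℂ H) - E) B := by
  constructor
  · constructor
    · intro h
      exact WeakSchur.exists_isAdmissibleProjection_of_factorization hB
        (WeakSchur.isWeakFactorization_reducedSolution S hB h) rfl
    · rintro ⟨E, hE⟩
      obtain ⟨X, hX⟩ :=
        hE.exists_eq_sqrtModulus_mul (WeakSchur.isSignedSqrt_compression S hB)
      exact WeakSchur.isWeaklyComplementable_of_eq_mul S hX
  · intro h E hE
    rw [WeakSchur.schurComplement_eq, hE.mulBounded_one_sub hB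
      (WeakSchur.isWeakFactorization_reducedSolution S hB h)]
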